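/- The state complexity of a regular language is the number of states of its minimal complete deterministic finite automaton (DFA). The state complexity of a binary operation on regular languages, at $(m,n)$, is the maximum state complexity of the result, taken over all finite alphabets $\Sigma$ and all regular languages $K,L$ over $\Sigma$ of state complexities $m$ and $n$, respectively. Let $\Sigma=\{a,b,c,d,e,f\}$. For $m,n\ge 3$ let $K_m$ be the language of the DFA with states $0,\dots,m-1$, initial state $0$ and only final state $m-1$, in which $a$ acts as the cycle $(0,1,\dots,m-1)$, $c$ acts as the cycle $(1,\dots,m-1)$ (fixing $0$), $e$ sends state $1$ to $0$ and fixes all other states, and $b,d,f$ act as the identity. Let $L_n$ be the language of the DFA with states $0,\dots,n-1$, initial state $0$ and only final state $n-1$, in which $a$ and $b$ both act as the cycle $(0,1,\dots,n-1)$, $d$ acts as the cycle $(1,\dots,n-1)$ (fixing $0$), $f$ sends state $1$ to $0$ and fixes all other states, and $c,e$ act as the identity. (These are the witnesses of Jirásková and Okhotin for $(K\cap L)^*$.) Let $\overline{L_n}=\Sigma^*\setminus L_n$. Theorem. For all $m,n\ge 3$, the state complexity of the operation $(K,L)\mapsto (K\setminus L)^*$ at $(m,n)$ is $2^{mn-1}+2^{mn-2}$.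 It is met by $K_m$ and $\overline{L_n}$: these languages have state complexities $m$ and $n$, respectively, and $(K_m\setminus\overline{L_n})^*$ has state complexity $2^{mn-1}+2^{mn-2}$. -/

import Mathlib

open scoped Computability

/-- The state complexity of a language: the least number of states of a (complete) deterministic
finite automaton recognizing it. It is `⊤` exactly when the language is not regular. -/
noncomputable def stateComplexity {α : Type} (L : Language α) : ℕ∞ :=
  ⨅ (k : ℕ) (_ : ∃ M : DFA α (Fin k), M.accepts = L), (k : ℕ∞)

/-- `IsOperationComplexity op m n N`: the state complexity of the binary operation `op` on
regular languages (over a common finite alphabet) is `N` at arguments of state complexities `m`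
and `n`, i.e. `N` is the worst-case (maximal, and attained) state complexity of the result. -/
def IsOperationComplexity
    (op : ∀ {α : Type}, Language α → Language α → Language α) (m n : ℕ) (N : ℕ∞) : Prop :=
  IsGreatest
    {c : ℕ∞ | ∃ (α : Type) (_ : Finite α) (K L : Language α),
      stateComplexity K = m ∧ stateComplexity L = n ∧ c = stateComplexity (op K L)} N

/-- The operation `(K \ L)∗`: star of the difference. -/
def starDiff {α : Type} (K L : Language α) : Language α := (K \ L)∗

/-- The six-letter alphabet. -/
inductive Letter
  | a | b | c | d | e | f
  deriving DecidableEq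

instance : Fintype Letter where
  elems := {.a, .b, .c, .d, .e, .f}
  complete := by intro x; cases x <;> decide

/-- The cycle `(0, 1, …, n-1)`. -/
def fullCycle {n : ℕ} (hn : 3 ≤ n) (i : Fin n) : Fin n :=
  if h : (i : ℕ) + 1 < n then ⟨i + 1, h⟩ else ⟨0, by omega⟩

/-- The cycle `(1, 2, …, n-1)`, fixing `0`. -/
def tailCycle {n : ℕ} (hn : 3 ≤ n) (i : Fin n) : Fin n :=
  if (i : ℕ) = 0 then i
  else if h : (i : ℕ) + 1 < n then ⟨i + 1, h⟩ else ⟨1, by omega⟩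

/-- The singular transformation sending `1` to `0` and fixing every other state. -/
def oneToZero {n : ℕ} (hn : 3 ≤ n) (i : Fin n) : Fin n :=
  if (i : ℕ) = 1 then ⟨0, by omega⟩ else i

/-- The first witness automaton, with states `0, …, m-1`, start `0`, accepting state `m-1`. -/
def dfaK (m : ℕ) (hm : 3 ≤ m) : DFA Letter (Fin m) where
  step i x := match x with
    | .a => fullCycle hm i
    | .b => i
    | .c => tailCycle hm i
    | .d => i
    | .e => oneToZero hm i
    | .f => i
  start := ⟨0, by omega⟩
  accept := {⟨m - 1, by omega⟩}

/-- The second witness automaton, with states `0, …, n-1`, start `0`, accepting state `n-1`. -/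
def dfaL (n : ℕ) (hn : 3 ≤ n) : DFA Letter (Fin n) where
  step i x := match x with
    | .a => fullCycle hn i
    | .b => fullCycle hn i
    | .c => i
    | .d => tailCycle hn i
    | .e => i
    | .f => oneToZero hn i
  start := ⟨0, by omega⟩
  accept := {⟨n - 1, by omega⟩}

/-- The first witness language `K_m`. -/
def witnessK (m : ℕ) (hm : 3 ≤ m) : Language Letter := (dfaK m hm).accepts

/-- The second witness language `L_n`. -/
def witnessL (n : ℕ) (hn : 3 ≤ n) : Language Letter := (dfaL n hn).accepts

/-! State complexity is counted by left quotients. The difference is accepted by a product automaton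
with `N = mn` states; let `s` be its start state. For its star, reading a nonempty word in
`starSubset` gives a nonempty set which, if it contains an accepting state `f ≠ s`, also contains
`s`. Discarding from the `2^N` subsets the empty one and the `2^(N-2)` that contain `f` but not `s`
leaves `2^(N-1) + 2^(N-2) - 1`, and the quotient by the empty word adds one. If no such `f` exists,
the star only adds the empty word and `N + 1` quotients suffice.

For the witnesses the difference is the intersection `K_m ∩ L_n`, with `f = (m-1, n-1)`.
Distinguishing is easy: powers of `a` and `b` carry a given state to `f` without entering `s` on the
way (`exists_distinguishing_word`).

Reachability of every closed set is by induction on cardinality (`starReach_of_mem_closedKL`). A set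
containing `f` arises from a smaller set, because entering `f` supplies `s` for free. At fixed
cardinality, the permutation letters reduce each spread set to one containing both `s` and `f`. A
set inside one row (first coordinate constant) or one column (second coordinate constant) stays in a
line under these permutations, so the merging letters `e` and `f` produce it from a spread set of
the same size; singletons in row `0` are reached directly by `b`. -/

/-! ### State complexity and left quotients -/

/-- The number of left quotients bounds the state complexity from below. -/
theorem encard_range_leftQuotient_le {α : Type} (L : Language α) :
    (Set.range L.leftQuotient).encard ≤ stateComplexity L := by
  refine le_iInf₂ fun k hk => ?_
  obtain ⟨M, rfl⟩ := hk
  rw [Language.leftQuotient_accepts]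
  calc (Set.range (M.acceptsFrom ∘ M.eval)).encard
      ≤ (M.acceptsFrom '' Set.univ).encard :=
        Set.encard_le_encard (by rintro _ ⟨w, rfl⟩; exact ⟨_, trivial, rfl⟩)
    _ ≤ (Set.univ : Set (Fin k)).encard := Set.encard_image_le _ _
    _ = k := by simp

theorem stateComplexity_accepts_le {α σ : Type} [Finite σ] (M : DFA α σ) :
    stateComplexity M.accepts ≤ Nat.card σ := by
  refine iInf₂_le (Nat.card σ) ⟨DFA.reindex (Finite.equivFin σ) M, ?_⟩
  rw [DFA.accepts_reindex]

/-- The state complexity of a language is its number of left quotients. -/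
theorem stateComplexity_eq_encard {α : Type} (L : Language α) :
    stateComplexity L = (Set.range L.leftQuotient).encard := by
  refine le_antisymm ?_ (encard_range_leftQuotient_le L)
  by_cases h : (Set.range L.leftQuotient).Finite
  · have := h.to_subtype
    calc stateComplexity L = stateComplexity L.toDFA.accepts := by rw [Language.accepts_toDFA]
      _ ≤ Nat.card (Set.range L.leftQuotient) := stateComplexity_accepts_le _
      _ = (Set.range L.leftQuotient).encard := by
        rw [Nat.card_coe_set_eq, h.cast_ncard_eq]
  · rw [Set.Infinite.encard_eq h]
    exact le_top

theorem exists_dfa_of_stateComplexity_eq {α : Type} {L : Language α} {k : ℕ}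
    (h : stateComplexity L = k) : ∃ (σ : Type) (_ : Finite σ) (M : DFA α σ),
      M.accepts = L ∧ Nat.card σ = k := by
  rw [stateComplexity_eq_encard] at h
  have hf : (Set.range L.leftQuotient).Finite := Set.finite_of_encard_eq_coe h
  obtain ⟨β, M, hM⟩ : ∃ (β : Set (Language α)) (M : DFA α β), M.accepts = L ∧
      β = Set.range L.leftQuotient := ⟨_, L.toDFA, by simp⟩
  obtain ⟨hM, rfl⟩ := hM
  have := hf.to_subtype
  refine ⟨Fin k, inferInstance, DFA.reindex ((Finite.equivFin _).trans (finCongr ?_)) M, ?_, ?_⟩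
  · rw [Nat.card_coe_set_eq, Set.ncard_def, h]
    rfl
  · rw [DFA.accepts_reindex, hM]
  · simp

/-- A DFA all of whose states are reachable and pairwise distinguishable is minimal. -/
theorem stateComplexity_eq_card {α σ : Type} [Finite σ] (M : DFA α σ)
    (hr : Function.Surjective M.eval) (hd : Function.Injective M.acceptsFrom) :
    stateComplexity M.accepts = Nat.card σ := by
  rw [stateComplexity_eq_encard, Language.leftQuotient_accepts, hr.range_comp,
    ← Set.image_univ, hd.encard_image, Set.encard_univ, ENat.card_eq_coe_natCard]

theorem stateComplexity_compl {α : Type} (L : Language α) :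
    stateComplexity Lᶜ = stateComplexity L := by
  have : ∀ (L : Language α), stateComplexity Lᶜ ≤ stateComplexity L := fun L =>
    le_iInf₂ fun k ⟨M, hM⟩ => iInf₂_le k ⟨Mᶜ, by rw [DFA.accepts_compl, hM]⟩
  refine le_antisymm (this L) ?_
  simpa using this Lᶜ

/-! ### The subset automaton for the star -/

namespace DFA

variable {α σ : Type} (M : DFA α σ)

/-- The subset automaton for the star of `M.accepts`: whenever an accepting state is entered, the
start state is added. It may differ from the star on the empty word only. -/
def starSubset : DFA α (Set σ) where
  step S x := (M.step · x) '' S ∪ {q | q = M.start ∧ ∃ p ∈ S, M.step p x ∈ M.accept}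
  start := {M.start}
  accept := {S | ∃ q ∈ S, q ∈ M.accept}

theorem mem_starSubset_step {S : Set σ} {x : α} {q : σ} :
    q ∈ M.starSubset.step S x ↔
      (∃ p ∈ S, M.step p x = q) ∨ q = M.start ∧ ∃ p ∈ S, M.step p x ∈ M.accept :=
  Iff.rfl

theorem mem_kstar_iff_exists_append {L : Language α} {w : List α} (hw : w ≠ []) :
    w ∈ L∗ ↔ ∃ u v, w = u ++ v ∧ u ∈ L∗ ∧ v ≠ [] ∧ v ∈ L := by
  constructor
  · rw [Language.mem_kstar_iff_exists_nonempty]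
    rintro ⟨T, rfl, hT⟩
    rcases List.eq_nil_or_concat T with rfl | ⟨T', v, rfl⟩
    · simp at hw
    · refine ⟨T'.flatten, v, by simp, Language.join_mem_kstar fun y hy => (hT y ?_).1,
        (hT v ?_).2, (hT v ?_).1⟩ <;> simp [*]
  · rintro ⟨u, v, rfl, hu, -, hv⟩
    rw [Language.mem_kstar] at hu ⊢
    obtain ⟨T, rfl, hT⟩ := hu
    refine ⟨T ++ [v], by simp, fun y hy => ?_⟩
    rcases List.mem_append.1 hy with h | h
    · exact hT y h
    · rw [List.mem_singleton.1 h]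
      exact hv

/-- The subset records all ways of cutting the input into a finished prefix `u` in the star and a
factor `v` still being read; `v = []` accounts for the added start state. -/
theorem mem_eval_starSubset {w : List α} {q : σ} : q ∈ M.starSubset.eval w ↔
    ∃ u v, w = u ++ v ∧ u ∈ M.accepts∗ ∧ M.eval v = q := by
  induction w using List.reverseRecOn generalizing q with
  | nil =>
    constructor
    · rintro rfl
      exact ⟨[], [], rfl, Language.nil_mem_kstar _, rfl⟩
    · rintro ⟨u, v, h, -, rfl⟩
      obtain ⟨rfl, rfl⟩ := List.append_eq_nil_iff.1 h.symm
      rfl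
  | append_singleton w x ih =>
    rw [eval_append_singleton, mem_starSubset_step]
    -- The start state is added exactly when the whole input read so far lies in the star.
    have hacc : (∃ p ∈ M.starSubset.eval w, M.step p x ∈ M.accept) ↔ w ++ [x] ∈ M.accepts∗ := by
      rw [mem_kstar_iff_exists_append (by simp)]
      constructor
      · rintro ⟨p, hp, hx⟩
        obtain ⟨u, v, rfl, hu, rfl⟩ := ih.1 hp
        exact ⟨u, v ++ [x], by simp, hu, by simp, by rw [mem_accepts]; simpa using hx⟩
      · rintro ⟨u, v, h, hu, hv, hvL⟩
        rcases List.eq_nil_or_concat v with rfl | ⟨v', y, rfl⟩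
        · exact absurd rfl hv
        · rw [List.concat_eq_append, ← List.append_assoc] at h
          obtain ⟨rfl, h'⟩ := List.append_inj' h rfl
          obtain rfl : x = y := by simpa using h'
          exact ⟨M.eval v', ih.2 ⟨u, v', rfl, hu, rfl⟩, by
            rw [mem_accepts] at hvL; simpa using hvL⟩
    rw [hacc]
    constructor
    · rintro (⟨p, hp, rfl⟩ | ⟨rfl, hw⟩)
      · obtain ⟨u, v, rfl, hu, rfl⟩ := ih.1 hp
        exact ⟨u, v ++ [x], by simp, hu, by simp⟩
      · exact ⟨w ++ [x], [], by simp, hw, rfl⟩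
    · rintro ⟨u, v, h, hu, rfl⟩
      rcases List.eq_nil_or_concat v with rfl | ⟨v', y, rfl⟩
      · right
        rw [List.append_nil] at h
        exact ⟨rfl, h ▸ hu⟩
      · left
        rw [List.concat_eq_append, ← List.append_assoc] at h
        obtain ⟨rfl, h'⟩ := List.append_inj' h rfl
        obtain rfl : x = y := by simpa using h'
        exact ⟨M.eval v', ih.2 ⟨u, v', rfl, hu, rfl⟩, by simp⟩

theorem mem_kstar_iff_mem_starSubset {w : List α} (hw : w ≠ []) :
    w ∈ M.accepts∗ ↔ w ∈ M.starSubset.accepts := by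
  rw [mem_accepts]
  constructor
  · intro h
    obtain ⟨u, v, rfl, hu, -, hv⟩ := (mem_kstar_iff_exists_append hw).1 h
    exact ⟨M.eval v, M.mem_eval_starSubset.2 ⟨u, v, rfl, hu, rfl⟩, hv⟩
  · rintro ⟨q, hq, hacc⟩
    obtain ⟨u, v, rfl, hu, rfl⟩ := M.mem_eval_starSubset.1 hq
    rcases eq_or_ne v [] with rfl | hv
    · simpa using hu
    · exact (mem_kstar_iff_exists_append hw).2 ⟨u, v, rfl, hu, hv, hacc⟩

theorem leftQuotient_kstar_eq {w : List α} (hw : w ≠ []) :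
    M.accepts∗.leftQuotient w = M.starSubset.acceptsFrom (M.starSubset.eval w) := by
  rw [← Language.leftQuotient_accepts_apply]
  ext y
  exact M.mem_kstar_iff_mem_starSubset (by simp [hw])

theorem eval_starSubset_nonempty (w : List α) : (M.starSubset.eval w).Nonempty :=
  ⟨M.eval w, M.mem_eval_starSubset.2 ⟨[], w, rfl, Language.nil_mem_kstar _, rfl⟩⟩

theorem start_mem_eval_starSubset {f : σ} (hf : f ∈ M.accept) (hne : f ≠ M.start) {w : List α}
    (h : f ∈ M.starSubset.eval w) : M.start ∈ M.starSubset.eval w := by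
  rcases eq_or_ne w [] with rfl | hw
  · exact absurd h hne
  · exact M.mem_eval_starSubset.2 ⟨w, [], by simp,
      (M.mem_kstar_iff_mem_starSubset hw).2 ⟨f, h, hf⟩, rfl⟩

end DFA

/-! ### Counting closed sets; bounds for the star -/

/-- The nonempty sets that contain `s` as soon as they contain `f`. -/
def closedSets {σ : Type} (s f : σ) : Set (Set σ) := {S | S.Nonempty ∧ (f ∈ S → s ∈ S)}

/-- The complement consists of the empty set and the interval from `{f}` to the complement of `{s}`.
The added `1` is reserved for the quotient by the empty word. -/
theorem encard_closedSets_add_one {σ : Type} [Finite σ] {s f : σ} (h : f ≠ s) :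
    (closedSets s f).encard + 1 =
      ((2 ^ (Nat.card σ - 1) + 2 ^ (Nat.card σ - 2) : ℕ) : ℕ∞) := by
  classical
  have := Fintype.ofFinite σ
  have hN : 2 ≤ Fintype.card σ := Fintype.one_lt_card_iff.2 ⟨f, s, h⟩
  rw [Nat.card_eq_fintype_card]
  obtain ⟨k, hk⟩ := Nat.exists_eq_add_of_le' hN
  let A : Finset (Finset σ) := Finset.Icc {f} (Finset.univ.erase s)
  have hA : A.card = 2 ^ k := by
    rw [Finset.card_Icc_finset (by simpa using h)]
    simp [hk]
  have h0 : ∅ ∉ A := by simp [A]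
  have hB : closedSets s f = (fun T : Finset σ => (T : Set σ)) '' ((insert ∅ A)ᶜ : Finset _) := by
    ext S
    have hmem : ∀ T : Finset σ, T ∈ (insert ∅ A)ᶜ ↔ T.Nonempty ∧ (f ∈ T → s ∈ T) := by
      intro T
      simp only [Finset.mem_compl, Finset.mem_insert, not_or, A, Finset.mem_Icc,
        Finset.singleton_subset_iff, Finset.subset_erase,
        Finset.subset_univ, true_and, Finset.nonempty_iff_ne_empty]
      tauto
    constructor
    · intro hS
      refine ⟨S.toFinite.toFinset, ?_, by simp⟩
      rw [Finset.mem_coe, hmem]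
      simpa [closedSets] using hS
    · rintro ⟨T, hT, rfl⟩
      rw [Finset.mem_coe, hmem] at hT
      simpa [closedSets] using hT
  rw [hB, Finset.coe_injective.encard_image, Set.encard_coe_eq_coe_finsetCard, Finset.card_compl,
    Finset.card_insert_of_notMem h0, hA, Fintype.card_finset, hk]
  norm_cast
  have h1 : 1 ≤ 2 ^ k := Nat.one_le_two_pow
  simp only [Nat.add_sub_cancel, show k + 2 - 1 = k + 1 by omega, pow_succ]
  omega

/-- The upper bound for the star of a language accepted by a DFA that has an accepting state
other than its start state. -/
theorem stateComplexity_kstar_le {α σ : Type} [Finite σ] (M : DFA α σ) {f : σ}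
    (hf : f ∈ M.accept) (hne : f ≠ M.start) : stateComplexity (M.accepts∗) ≤
      ((2 ^ (Nat.card σ - 1) + 2 ^ (Nat.card σ - 2) : ℕ) : ℕ∞) := by
  rw [stateComplexity_eq_encard, ← encard_closedSets_add_one hne]
  calc (Set.range (M.accepts∗).leftQuotient).encard
      ≤ (insert (M.accepts∗) (M.starSubset.acceptsFrom '' closedSets M.start f)).encard := by
        refine Set.encard_le_encard ?_
        rintro _ ⟨w, rfl⟩
        rcases eq_or_ne w [] with rfl | hw
        · exact Set.mem_insert _ _
        · exact Set.mem_insert_of_mem _ ⟨M.starSubset.eval w, ⟨M.eval_starSubset_nonempty w,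
            M.start_mem_eval_starSubset hf hne⟩, (M.leftQuotient_kstar_eq hw).symm⟩
    _ ≤ _ := (Set.encard_insert_le _ _).trans (by gcongr; exact Set.encard_image_le _ _)

/-- If only the start state may be accepting, the star adds at most one state. -/
theorem stateComplexity_kstar_le_of_accept_subset {α σ : Type} [Finite σ] (M : DFA α σ)
    (h : M.accept ⊆ {M.start}) : stateComplexity (M.accepts∗) ≤ Nat.card σ + 1 := by
  -- Each accepted factor leads back to the start state, so a product of accepted words is accepted.
  have key : ∀ w : List α, w ≠ [] → (w ∈ M.accepts∗ ↔ w ∈ M.accepts) := by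
    intro w
    induction hl : w.length using Nat.strong_induction_on generalizing w with
    | _ l ih =>
      intro hw
      constructor
      · intro hs
        obtain ⟨u, v, rfl, hu, hv, hvL⟩ := (DFA.mem_kstar_iff_exists_append hw).1 hs
        rcases eq_or_ne u [] with rfl | hu'
        · exact hvL
        · have hu2 : u ∈ M.accepts := (ih u.length (by
            have := List.length_pos_iff.2 hv
            simp at hl
            omega) u rfl hu').1 hu
          have he : M.eval u = M.start := h hu2
          rw [DFA.mem_accepts, DFA.eval, DFA.evalFrom_of_append]
          change M.evalFrom (M.eval u) v ∈ _
          rw [he]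
          exact hvL
      · intro hs
        exact Language.mem_kstar.2 ⟨[w], by simp, by simpa using hs⟩
  rw [stateComplexity_eq_encard]
  calc (Set.range (M.accepts∗).leftQuotient).encard
      ≤ (insert (M.accepts∗) (M.acceptsFrom '' Set.univ)).encard := by
        refine Set.encard_le_encard ?_
        rintro _ ⟨w, rfl⟩
        rcases eq_or_ne w [] with rfl | hw
        · exact Set.mem_insert _ _
        · refine Set.mem_insert_of_mem _ ⟨M.eval w, trivial, ?_⟩
          rw [← Language.leftQuotient_accepts_apply]
          ext y
          exact (key _ (by simp [hw])).symm
    _ ≤ (M.acceptsFrom '' Set.univ).encard + 1 := Set.encard_insert_le _ _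
    _ ≤ (Set.univ : Set σ).encard + 1 := by gcongr; exact Set.encard_image_le _ _
    _ = _ := by rw [Set.encard_univ, ENat.card_eq_coe_natCard]

/-- The lower bound for the star: every closed set is reachable by a nonempty word, and every state
`q` has a word accepted from exactly the sets containing `q`. -/
theorem le_stateComplexity_kstar {α σ : Type} [Finite σ] (M : DFA α σ) {f : σ}
    (hs : M.start ∉ M.accept) (hne : f ≠ M.start)
    (hr : ∀ S ∈ closedSets M.start f, ∃ w, w ≠ [] ∧ M.starSubset.eval w = S)
    (hd : ∀ q, ∃ y, y ≠ [] ∧ ∀ S, y ∈ M.starSubset.acceptsFrom S ↔ q ∈ S) :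
    ((2 ^ (Nat.card σ - 1) + 2 ^ (Nat.card σ - 2) : ℕ) : ℕ∞) ≤ stateComplexity (M.accepts∗) := by
  rw [stateComplexity_eq_encard, ← encard_closedSets_add_one hne]
  have hinj : Function.Injective M.starSubset.acceptsFrom := by
    intro S T hST
    ext q
    obtain ⟨y, -, hy⟩ := hd q
    rw [← hy, ← hy, hST]
  -- The quotient by the empty word is new: nonempty distinguishing words would force `S =
  -- {M.start}`, which rejects the empty word, whereas the star contains it.
  have hnot : M.accepts∗ ∉ M.starSubset.acceptsFrom '' closedSets M.start f := by
    rintro ⟨S, ⟨⟨p, hp⟩, -⟩, hS⟩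
    have hmem : ∀ y, y ≠ [] → (y ∈ M.starSubset.acceptsFrom S ↔
        y ∈ M.starSubset.acceptsFrom {M.start}) := fun y hy => by
      rw [hS]
      exact M.mem_kstar_iff_mem_starSubset hy
    have hSs : S = {M.start} := by
      ext q
      obtain ⟨y, hy, hyS⟩ := hd q
      rw [← hyS, hmem y hy, hyS]
    have hnil : [] ∈ M.starSubset.acceptsFrom S := hS ▸ Language.nil_mem_kstar _
    obtain ⟨q, hq, hqa⟩ := hnil
    rw [DFA.evalFrom_nil, hSs] at hq
    rw [Set.mem_singleton_iff.1 hq] at hqa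
    exact hs hqa
  rw [← hinj.encard_image, ← Set.encard_insert_of_notMem hnot]
  refine Set.encard_le_encard (Set.insert_subset ⟨[], rfl⟩ ?_)
  rintro _ ⟨S, hS, rfl⟩
  obtain ⟨w, hw, rfl⟩ := hr S hS
  exact ⟨w, M.leftQuotient_kstar_eq hw⟩

theorem stateComplexity_starDiff_le {α : Type} {m n : ℕ} (hm : 3 ≤ m) (hn : 3 ≤ n)
    {K L : Language α} (hK : stateComplexity K = m) (hL : stateComplexity L = n) :
    stateComplexity (starDiff K L) ≤ ((2 ^ (m * n - 1) + 2 ^ (m * n - 2) : ℕ) : ℕ∞) := by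
  obtain ⟨σ, _, M, rfl, hσ⟩ := exists_dfa_of_stateComplexity_eq hK
  obtain ⟨τ, _, N, rfl, hτ⟩ := exists_dfa_of_stateComplexity_eq hL
  have hP : starDiff M.accepts N.accepts = (M.inter Nᶜ).accepts∗ := by
    rw [DFA.accepts_inter, DFA.accepts_compl]
    rfl
  have hcard : Nat.card (σ × τ) = m * n := by rw [Nat.card_prod, hσ, hτ]
  rw [hP, ← hcard]
  by_cases h : (M.inter Nᶜ).accept ⊆ {(M.inter Nᶜ).start}
  · refine (stateComplexity_kstar_le_of_accept_subset _ h).trans ?_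
    rw [hcard]
    norm_cast
    have h9 : 9 ≤ m * n := Nat.mul_le_mul hm hn
    generalize m * n = N at h9
    have : N - 1 < 2 ^ (N - 1) := Nat.lt_two_pow_self
    have h2 : 2 ^ 1 ≤ 2 ^ (N - 2) := Nat.pow_le_pow_right (by norm_num) (by omega)
    omega
  · obtain ⟨f, hf, hne⟩ := Set.not_subset.1 h
    exact stateComplexity_kstar_le _ hf hne

/-! ### The cycles on `Fin n` -/

section Maps

variable {n : ℕ} (hn : 3 ≤ n)

theorem val_fullCycle_iterate (l : ℕ) (i : Fin n) :
    ((fullCycle hn)^[l] i : ℕ) = (i + l) % n := by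
  induction l with
  | zero => simp [Nat.mod_eq_of_lt i.2]
  | succ l ih =>
    rw [Function.iterate_succ_apply', fullCycle]
    have hlt : (i + l) % n < n := Nat.mod_lt _ (by omega)
    rw [← Nat.add_assoc, Nat.add_mod_eq_ite, ← ih, Nat.mod_eq_of_lt (show 1 < n by omega)]
    have := ((fullCycle hn)^[l] i).2
    split_ifs <;> (try simp only []) <;> omega

theorem fullCycle_last : fullCycle hn ⟨n - 1, by omega⟩ = ⟨0, by omega⟩ := by
  unfold fullCycle
  rw [dif_neg (by simp only []; omega)]

theorem fullCycle_bijective : Function.Bijective (fullCycle hn) := by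
  refine Finite.injective_iff_bijective.1 fun i j h => ?_
  have h := congrArg Fin.val h
  unfold fullCycle at h
  ext
  split_ifs at h <;> simp only [] at h <;> omega

theorem val_tailCycle (i : Fin n) : (tailCycle hn i : ℕ) =
    if (i : ℕ) = 0 then 0 else if (i : ℕ) + 1 < n then (i : ℕ) + 1 else 1 := by
  unfold tailCycle
  split_ifs <;> simp_all

theorem tailCycle_bijective : Function.Bijective (tailCycle hn) := by
  refine Finite.injective_iff_bijective.1 fun i j h => ?_
  have h := congrArg Fin.val h
  rw [val_tailCycle, val_tailCycle] at h
  ext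
  split_ifs at h <;> omega

theorem tailCycle_zero : tailCycle hn ⟨0, by omega⟩ = ⟨0, by omega⟩ := by
  simp [tailCycle]

theorem tailCycle_iterate_zero (l : ℕ) : (tailCycle hn)^[l] ⟨0, by omega⟩ = ⟨0, by omega⟩ :=
  Function.iterate_fixed (tailCycle_zero hn) l

theorem tailCycle_iterate_last (l : ℕ) (hl : l + 1 < n) :
    (tailCycle hn)^[l + 1] ⟨n - 1, by omega⟩ = ⟨l + 1, hl⟩ := by
  induction l with
  | zero =>
    ext
    rw [Function.iterate_succ_apply', val_tailCycle, Function.iterate_zero_apply,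
      if_neg (by simp only []; omega), if_neg (by simp only []; omega)]
  | succ l ih =>
    rw [Function.iterate_succ_apply', ih (by omega)]
    ext
    rw [val_tailCycle, if_neg (by simp), if_pos hl]

theorem exists_tailCycle_iterate (i : Fin n) (hi : (i : ℕ) ≠ 0) :
    ∃ l, (tailCycle hn)^[l] ⟨n - 1, by omega⟩ = i := by
  obtain ⟨_ | i, hin⟩ := i
  · exact absurd rfl hi
  · exact ⟨_, tailCycle_iterate_last hn i hin⟩

end Maps

/-! ### Backward moves in the subset automaton -/

namespace DFA

variable {α σ : Type} (M : DFA α σ)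

theorem evalFrom_replicate (x : α) (l : ℕ) (q : σ) :
    M.evalFrom q (List.replicate l x) = (M.step · x)^[l] q := by
  induction l generalizing q with
  | zero => rfl
  | succ l ih => rw [List.replicate_succ, evalFrom_cons, ih, Function.iterate_succ_apply]

/-- A word accepted from exactly one state of a subset automaton can be extended backwards along
an injective letter unless it leads into the start state. -/
theorem mem_acceptsFrom_starSubset_cons {x : α} (hx : Function.Injective (M.step · x)) {p q : σ}
    (hp : M.step p x = q) (hq : q ≠ M.start) {y : List α}
    (hy : ∀ S, y ∈ M.starSubset.acceptsFrom S ↔ q ∈ S) (S : Set σ) :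
    x :: y ∈ M.starSubset.acceptsFrom S ↔ p ∈ S := by
  rw [mem_acceptsFrom, evalFrom_cons]
  refine (hy _).trans ?_
  rw [mem_starSubset_step]
  constructor
  · rintro (⟨p', hp', h⟩ | ⟨h, -⟩)
    · rwa [← hx (h.trans hp.symm)]
    · exact absurd h hq
  · exact fun h => Or.inl ⟨p, h, hp⟩

/-- `S` is reached by a nonempty word in the subset automaton for the star. -/
def StarReach (S : Set σ) : Prop := ∃ w, w ≠ [] ∧ M.starSubset.eval w = S

variable {M}

theorem StarReach.step {S : Set σ} (h : M.StarReach S) (x : α) :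
    M.StarReach (M.starSubset.step S x) := by
  obtain ⟨w, -, rfl⟩ := h
  exact ⟨w ++ [x], by simp, by simp⟩

/-- The step returns exactly `S`: the start state is added only if `f ∈ S`, and then closedness
already puts it in `S`. -/
theorem StarReach.of_preimage {f : σ} (hf : M.accept = {f}) {S : Set σ}
    (hS : S ∈ closedSets M.start f) {x : α} (hx : Function.Bijective (M.step · x))
    (h : M.StarReach ((M.step · x) ⁻¹' S)) : M.StarReach S := by
  convert h.step x using 1
  ext q
  rw [mem_starSubset_step]
  constructor
  · intro hq
    obtain ⟨p, rfl⟩ := hx.2 q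
    exact Or.inl ⟨p, hq, rfl⟩
  · rintro (⟨p, hp, rfl⟩ | ⟨rfl, p, hp, hpf⟩)
    · exact hp
    · rw [hf] at hpf
      exact hS.2 (Set.mem_singleton_iff.1 hpf ▸ hp)

/-- A set containing the accepting state is obtained, along a bijective letter, from a set with one
element less. -/
theorem StarReach.of_mem_accept [Finite σ] {f : σ} (hf : M.accept = {f}) (hne : f ≠ M.start)
    {S : Set σ} (hS : S ∈ closedSets M.start f) (hfS : f ∈ S) {x : α}
    (hx : Function.Bijective (M.step · x)) (hxf : M.step f x = M.start)
    (ih : ∀ T ∈ closedSets M.start f, T.ncard < S.ncard → M.StarReach T) : M.StarReach S := by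
  have hsS := hS.2 hfS
  have hpre : M.StarReach ((M.step · x) ⁻¹' (S \ {M.start})) := by
    refine ih _ ⟨?_, fun h => ?_⟩ ?_
    · obtain ⟨p, hp : M.step p x = f⟩ := hx.2 f
      exact ⟨p, by rw [Set.mem_preimage, hp]; exact ⟨hfS, hne⟩⟩
    · exact absurd hxf h.2
    · rw [Set.ncard_preimage_of_injective_subset_range hx.1 (by simp [hx.2.range_eq])]
      exact Set.ncard_sdiff_singleton_lt_of_mem hsS
  convert hpre.step x using 1
  ext q
  rw [mem_starSubset_step]
  constructor
  · intro hq
    by_cases hqs : q = M.start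
    · obtain ⟨p, hp : M.step p x = f⟩ := hx.2 f
      exact Or.inr ⟨hqs, p, by rw [Set.mem_preimage, hp]; exact ⟨hfS, hne⟩, by rw [hp, hf]; rfl⟩
    · obtain ⟨p, rfl⟩ := hx.2 q
      exact Or.inl ⟨p, ⟨hq, hqs⟩, rfl⟩
  · rintro (⟨p, hp, rfl⟩ | ⟨rfl, -⟩)
    · exact hp.1
    · exact hsS

/-- Merging: a set avoiding the accepting state is the image of `T`. -/
theorem StarReach.of_image {f : σ} (hf : M.accept = {f}) {S T : Set σ} {x : α}
    (hT : M.StarReach T) (h : (M.step · x) '' T = S) (hfS : f ∉ S) : M.StarReach S := by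
  convert hT.step x using 1
  subst h
  ext q
  rw [mem_starSubset_step]
  constructor
  · exact Or.inl
  · rintro (h | ⟨-, p, hp, hpf⟩)
    · exact h
    · rw [hf] at hpf
      exact absurd ⟨p, hp, hpf⟩ hfS

end DFA

/-! ### The product witness and distinguishability -/

/-- The intersection of the two witness automata. -/
abbrev dfaKL (m n : ℕ) (hm : 3 ≤ m) (hn : 3 ≤ n) : DFA Letter (Fin m × Fin n) :=
  (dfaK m hm).inter (dfaL n hn)

/-- The set has two states that differ in both components. -/
def Spread {β γ : Type} (S : Set (β × γ)) : Prop := ∃ p ∈ S, ∃ q ∈ S, p.1 ≠ q.1 ∧ p.2 ≠ q.2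

section Witness

variable {m n : ℕ} (hm : 3 ≤ m) (hn : 3 ≤ n)

theorem dfaKL_accept : (dfaKL m n hm hn).accept = {(⟨m - 1, by omega⟩, ⟨n - 1, by omega⟩)} := by
  ext ⟨i, j⟩
  simp [dfaK, dfaL]

theorem dfaKL_step_b : ((dfaKL m n hm hn).step · .b) = Prod.map id (fullCycle hn) := rfl
theorem dfaKL_step_c : ((dfaKL m n hm hn).step · .c) = Prod.map (tailCycle hm) id := rfl
theorem dfaKL_step_d : ((dfaKL m n hm hn).step · .d) = Prod.map id (tailCycle hn) := rfl
theorem dfaKL_step_e : ((dfaKL m n hm hn).step · .e) = Prod.map (oneToZero hm) id := rfl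
theorem dfaKL_step_f : ((dfaKL m n hm hn).step · .f) = Prod.map id (oneToZero hn) := rfl

theorem dfaKL_bijective_a : Function.Bijective ((dfaKL m n hm hn).step · .a) :=
  (fullCycle_bijective hm).prodMap (fullCycle_bijective hn)
theorem dfaKL_bijective_b : Function.Bijective ((dfaKL m n hm hn).step · .b) :=
  Function.bijective_id.prodMap (fullCycle_bijective hn)
theorem dfaKL_bijective_c : Function.Bijective ((dfaKL m n hm hn).step · .c) :=
  (tailCycle_bijective hm).prodMap Function.bijective_id
theorem dfaKL_bijective_d : Function.Bijective ((dfaKL m n hm hn).step · .d) :=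
  Function.bijective_id.prodMap (tailCycle_bijective hn)

theorem Spread.preimage {β γ : Type} {φ : β → β} {ψ : γ → γ} (hφ : Function.Surjective φ)
    (hψ : Function.Surjective ψ) {S : Set (β × γ)} (h : Spread S) :
    Spread (Prod.map φ ψ ⁻¹' S) := by
  obtain ⟨⟨i, j⟩, hp, ⟨i', j'⟩, hq, h1, h2⟩ := h
  obtain ⟨i, rfl⟩ := hφ i
  obtain ⟨j, rfl⟩ := hψ j
  obtain ⟨i', rfl⟩ := hφ i'
  obtain ⟨j', rfl⟩ := hψ j'
  exact ⟨(i, j), hp, (i', j'), hq, fun h => h1 (congrArg φ h), fun h => h2 (congrArg ψ h)⟩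

/-- Every state has a word that the subset automaton accepts from exactly the sets containing it. -/
theorem exists_distinguishing_word (q : Fin m × Fin n) : ∃ y, y ≠ [] ∧
    ∀ S, y ∈ (dfaKL m n hm hn).starSubset.acceptsFrom S ↔ q ∈ S := by
  -- The two inequalities say `j + k = n - 1`. In row `m - 1` the word `b^k` leads to the accepting
  -- state and never meets the start state, which lies in row `0`.
  have hrow : ∀ k : ℕ, ∀ j : Fin n, n - 1 ≤ (j : ℕ) + k → (j : ℕ) + k ≤ n - 1 →
      ∃ y : List Letter, y.length = k ∧
        ∀ S, y ∈ (dfaKL m n hm hn).starSubset.acceptsFrom S ↔ (⟨m - 1, by omega⟩, j) ∈ S := by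
    intro k
    induction k with
    | zero =>
      intro j h1 h2
      refine ⟨[], rfl, fun S => ?_⟩
      rw [show j = ⟨n - 1, by omega⟩ from Fin.ext (by simp only []; omega)]
      rw [DFA.mem_acceptsFrom, DFA.evalFrom_nil]
      simp only [DFA.starSubset, dfaKL_accept]
      exact ⟨fun ⟨q, hq, h⟩ => Set.mem_singleton_iff.1 h ▸ hq, fun h => ⟨_, h, rfl⟩⟩
    | succ k ih =>
      intro j h1 h2
      have hlt : (j : ℕ) + 1 < n := by omega
      obtain ⟨y, hyl, hy⟩ := ih ⟨j + 1, hlt⟩ (by simp only []; omega) (by simp only []; omega)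
      refine ⟨.b :: y, by simp [hyl], (dfaKL m n hm hn).mem_acceptsFrom_starSubset_cons
        (dfaKL_bijective_b hm hn).1 ?_ ?_ hy⟩
      · simp [dfaK, dfaL, fullCycle, hlt]
      · simp [dfaK, dfaL]
  have hrow' : ∀ j : Fin n, ∃ y : List Letter, y ≠ [] ∧
        ∀ S, y ∈ (dfaKL m n hm hn).starSubset.acceptsFrom S ↔ (⟨m - 1, by omega⟩, j) ∈ S := by
    intro j
    by_cases hj : (j : ℕ) = n - 1
    -- At the accepting state a nonempty word is still needed, so `b` is read through a full turn.
    · obtain ⟨y, hyl, hy⟩ := hrow (n - 1) ⟨0, by omega⟩ (by simp) (by simp)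
      refine ⟨.b :: y, by simp, (dfaKL m n hm hn).mem_acceptsFrom_starSubset_cons
        (dfaKL_bijective_b hm hn).1 ?_ ?_ hy⟩
      · rw [show j = ⟨n - 1, by omega⟩ from Fin.ext hj]
        simpa [dfaK, dfaL] using fullCycle_last hn
      · have : m - 1 ≠ 0 := by omega
        simp [dfaK, dfaL, this]
    · obtain ⟨y, hyl, hy⟩ := hrow (n - 1 - j) j (by omega) (by omega)
      refine ⟨y, ?_, hy⟩
      rintro rfl
      simp only [List.length_nil] at hyl
      omega
  have hall : ∀ k : ℕ, ∀ i : Fin m, (i : ℕ) + k = m - 1 → ∀ j : Fin n,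
      ∃ y : List Letter, y ≠ [] ∧
        ∀ S, y ∈ (dfaKL m n hm hn).starSubset.acceptsFrom S ↔ (i, j) ∈ S := by
    intro k
    induction k with
    | zero =>
      intro i hi j
      rw [show i = ⟨m - 1, by omega⟩ from Fin.ext hi]
      exact hrow' j
    | succ k ih =>
      intro i hi j
      have hlt : (i : ℕ) + 1 < m := by omega
      obtain ⟨y, -, hy⟩ := ih ⟨i + 1, hlt⟩ (by simp only []; omega) (fullCycle hn j)
      refine ⟨.a :: y, by simp, (dfaKL m n hm hn).mem_acceptsFrom_starSubset_cons
        (dfaKL_bijective_a hm hn).1 ?_ ?_ hy⟩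
      · simp [dfaK, dfaL, fullCycle, hlt]
      · simp [dfaK, dfaL]
  exact hall (m - 1 - q.1) q.1 (by omega) q.2

end Witness

/-! ### Reachability of spread sets -/

/-- The closed sets of states of the intersection automaton. -/
abbrev closedKL (m n : ℕ) (hm : 3 ≤ m) (hn : 3 ≤ n) : Set (Set (Fin m × Fin n)) :=
  closedSets (dfaKL m n hm hn).start (⟨m - 1, by omega⟩, ⟨n - 1, by omega⟩)

/-- Spread sets with `k` elements, the class of sets treated in one step of the induction. -/
def SpreadCard {m n : ℕ} (k : ℕ) (S : Set (Fin m × Fin n)) : Prop := Spread S ∧ S.ncard = k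

/-- Spread sets with `k` elements that contain the start state and the accepting state are
reachable. -/
def LastReach (m n : ℕ) (hm : 3 ≤ m) (hn : 3 ≤ n) (k : ℕ) : Prop :=
  ∀ S : Set (Fin m × Fin n), SpreadCard k S → (dfaKL m n hm hn).start ∈ S →
    (⟨m - 1, by omega⟩, ⟨n - 1, by omega⟩) ∈ S → (dfaKL m n hm hn).StarReach S

section Reach

variable {m n : ℕ} {hm : 3 ≤ m} {hn : 3 ≤ n}

theorem dfaKL_start : (dfaKL m n hm hn).start = (⟨0, by omega⟩, ⟨0, by omega⟩) := rfl

theorem closedKL_of_start_mem {S : Set (Fin m × Fin n)} (h : (dfaKL m n hm hn).start ∈ S) :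
    S ∈ closedKL m n hm hn := ⟨⟨_, h⟩, fun _ => h⟩

theorem last_ne_start :
    ((⟨m - 1, by omega⟩, ⟨n - 1, by omega⟩) : Fin m × Fin n) ≠ (dfaKL m n hm hn).start := by
  have : m - 1 ≠ 0 := by omega
  simp [dfaK, dfaL, this]

/-- Pulling back along `a` a set avoiding the start state gives a closed set. -/
theorem preimage_a_mem_closedKL {S : Set (Fin m × Fin n)} (hne : S.Nonempty)
    (h : (dfaKL m n hm hn).start ∉ S) :
    Prod.map (fullCycle hm) (fullCycle hn) ⁻¹' S ∈ closedKL m n hm hn := by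
  refine ⟨hne.preimage (dfaKL_bijective_a hm hn).2, fun hS => absurd ?_ h⟩
  rwa [Set.mem_preimage, Prod.map_apply, fullCycle_last, fullCycle_last] at hS

theorem ncard_preimage_of_bijective {β : Type} {φ : β → β} (hφ : Function.Bijective φ)
    (S : Set β) : (φ ⁻¹' S).ncard = S.ncard :=
  Set.ncard_preimage_of_injective_subset_range hφ.1 (by simp [hφ.2.range_eq])

variable {k : ℕ} {S : Set (Fin m × Fin n)}

theorem SpreadCard.nonempty (h : SpreadCard k S) : S.Nonempty :=
  let ⟨p, hp, _⟩ := h.1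
  ⟨p, hp⟩

theorem SpreadCard.preimage {φ : Fin m → Fin m} {ψ : Fin n → Fin n} (hφ : Function.Bijective φ)
    (hψ : Function.Bijective ψ) (h : SpreadCard k S) : SpreadCard k (Prod.map φ ψ ⁻¹' S) :=
  ⟨h.1.preimage hφ.2 hψ.2, by rw [ncard_preimage_of_bijective (hφ.prodMap hψ), h.2]⟩

/-- Since `c` fixes row `0`, every successive preimage contains the start state and is therefore
closed. -/
theorem starReach_of_preimage_c_iterate (l : ℕ) (hS : (dfaKL m n hm hn).start ∈ S)
    (h : (dfaKL m n hm hn).StarReach (Prod.map ((tailCycle hm)^[l]) id ⁻¹' S)) :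
    (dfaKL m n hm hn).StarReach S := by
  induction l generalizing S with
  | zero => exact h
  | succ l ih =>
    refine DFA.StarReach.of_preimage (dfaKL_accept hm hn) (closedKL_of_start_mem hS)
      (dfaKL_bijective_c hm hn) (ih ?_ ?_)
    · rw [dfaKL_step_c, dfaKL_start, Set.mem_preimage, Prod.map_apply, tailCycle_zero]
      exact hS
    · rw [Function.iterate_succ'] at h
      exact h

theorem starReach_of_preimage_d_iterate (l : ℕ) (hS : (dfaKL m n hm hn).start ∈ S)
    (h : (dfaKL m n hm hn).StarReach (Prod.map id ((tailCycle hn)^[l]) ⁻¹' S)) :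
    (dfaKL m n hm hn).StarReach S := by
  induction l generalizing S with
  | zero => exact h
  | succ l ih =>
    refine DFA.StarReach.of_preimage (dfaKL_accept hm hn) (closedKL_of_start_mem hS)
      (dfaKL_bijective_d hm hn) (ih ?_ ?_)
    · rw [dfaKL_step_d, dfaKL_start, Set.mem_preimage, Prod.map_apply, tailCycle_zero]
      exact hS
    · rw [Function.iterate_succ'] at h
      exact h

/-- The letters `c` and `d` rotate nonzero rows and nonzero columns independently and fix the start
state, so `(i, j)` can be pulled back to the accepting state. -/
theorem starReach_of_start_mem_of_ne_zero (hF : LastReach m n hm hn k)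
    (hS : SpreadCard k S)
    (h0 : (dfaKL m n hm hn).start ∈ S) {i : Fin m} {j : Fin n} (hij : (i, j) ∈ S)
    (hi : (i : ℕ) ≠ 0) (hj : (j : ℕ) ≠ 0) : (dfaKL m n hm hn).StarReach S := by
  obtain ⟨l, rfl⟩ := exists_tailCycle_iterate hm i hi
  obtain ⟨l', rfl⟩ := exists_tailCycle_iterate hn j hj
  have h1 : (dfaKL m n hm hn).start ∈ Prod.map ((tailCycle hm)^[l]) id ⁻¹' S := by
    rw [Set.mem_preimage, dfaKL_start, Prod.map_apply, tailCycle_iterate_zero]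
    exact h0
  refine starReach_of_preimage_c_iterate l h0 (starReach_of_preimage_d_iterate l' h1 (hF _ ?_ ?_ ?_))
  · exact (hS.preimage ((tailCycle_bijective hm).iterate l) Function.bijective_id).preimage
      Function.bijective_id ((tailCycle_bijective hn).iterate l')
  · rw [Set.mem_preimage, dfaKL_start, Prod.map_apply, tailCycle_iterate_zero]
    exact h1
  · exact hij

/-- The remaining case is a set inside row `0` and column `0`. Once `(0, 1)` is present, pulling
back along `b` turns it into the start state and turns `(i, 0)` into `(i, n-1)`, which has both
coordinates nonzero. -/
theorem starReach_of_start_mem (hF : LastReach m n hm hn k)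
    (hS : SpreadCard k S) (h0 : (dfaKL m n hm hn).start ∈ S) :
    (dfaKL m n hm hn).StarReach S := by
  by_cases hij : ∃ p ∈ S, (p.1 : ℕ) ≠ 0 ∧ (p.2 : ℕ) ≠ 0
  · obtain ⟨p, hp, h1, h2⟩ := hij
    exact starReach_of_start_mem_of_ne_zero hF hS h0 hp h1 h2
  push Not at hij
  -- `S` is contained in a cross and meets both of its arms
  have hcross : ∃ (i : Fin m) (j : Fin n), (i : ℕ) ≠ 0 ∧ (j : ℕ) ≠ 0 ∧
      (i, ⟨0, by omega⟩) ∈ S ∧ (⟨0, by omega⟩, j) ∈ S := by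
    have aux : ∀ p ∈ S, ∀ q ∈ S, p.1 ≠ q.1 → p.2 ≠ q.2 → (p.1 : ℕ) ≠ 0 →
        ∃ (i : Fin m) (j : Fin n), (i : ℕ) ≠ 0 ∧ (j : ℕ) ≠ 0 ∧
          (i, ⟨0, by omega⟩) ∈ S ∧ (⟨0, by omega⟩, j) ∈ S := by
      rintro ⟨i, j⟩ hp ⟨i', j'⟩ hq h1 h2 hi
      have hj : (j : ℕ) = 0 := hij _ hp hi
      have hj' : (j' : ℕ) ≠ 0 := fun h => h2 (Fin.ext (hj.trans h.symm))
      have hi' : (i' : ℕ) = 0 := by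
        by_contra h
        exact hj' (hij _ hq h)
      refine ⟨i, j', hi, hj', ?_, ?_⟩
      · rwa [show (⟨0, by omega⟩ : Fin n) = j from Fin.ext hj.symm]
      · rwa [show (⟨0, by omega⟩ : Fin m) = i' from Fin.ext hi'.symm]
    obtain ⟨p, hp, q, hq, h1, h2⟩ := hS.1
    by_cases hpi : (p.1 : ℕ) = 0
    · exact aux q hq p hp h1.symm h2.symm fun h => h1 (Fin.ext (hpi.trans h.symm))
    · exact aux p hp q hq h1 h2 hpi
  obtain ⟨i, j, hi0, hj0, hi, hj⟩ := hcross
  -- rotate columns so that `(0, 1)` belongs to the set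
  have hl : ∃ l, (tailCycle hn)^[l] ⟨1, by omega⟩ = j := by
    obtain ⟨_ | t, ht⟩ := j
    · exact absurd rfl hj0
    · obtain ⟨l, hl⟩ : ∃ l, l = t := ⟨t, rfl⟩
      refine ⟨l, ?_⟩
      rw [← tailCycle_iterate_last hn 0 (by omega), ← Function.iterate_add_apply, hl]
      exact tailCycle_iterate_last hn t ht
  obtain ⟨l, rfl⟩ := hl
  refine starReach_of_preimage_d_iterate l h0 ?_
  set T := Prod.map id ((tailCycle hn)^[l]) ⁻¹' S with hT
  have hTS : SpreadCard k T :=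
    hS.preimage Function.bijective_id ((tailCycle_bijective hn).iterate l)
  have hT0 : (dfaKL m n hm hn).start ∈ T := by
    rw [hT, Set.mem_preimage, dfaKL_start, Prod.map_apply, tailCycle_iterate_zero]
    exact h0
  have hTi : (i, ⟨0, by omega⟩) ∈ T := by
    rw [hT, Set.mem_preimage, Prod.map_apply, tailCycle_iterate_zero]
    exact hi
  have hT1 : (⟨0, by omega⟩, ⟨1, by omega⟩) ∈ T := hj
  refine DFA.StarReach.of_preimage (dfaKL_accept hm hn) (closedKL_of_start_mem hT0)
    (dfaKL_bijective_b hm hn) ?_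
  refine starReach_of_start_mem_of_ne_zero hF (i := i) (j := ⟨n - 1, by omega⟩)
    (hTS.preimage Function.bijective_id (fullCycle_bijective hn)) ?_ ?_ hi0
    (show n - 1 ≠ 0 by omega)
  · have : fullCycle hn ⟨0, by omega⟩ = ⟨1, by omega⟩ := by
      unfold fullCycle
      rw [dif_pos (by simp only []; omega)]
    rw [dfaKL_start, dfaKL_step_b, Set.mem_preimage, Prod.map_apply, this]
    exact hT1
  · rw [dfaKL_step_b, Set.mem_preimage, Prod.map_apply, fullCycle_last]
    exact hTi

/-- Spread sets may be pulled back along any power of `a`. -/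
theorem starReach_of_preimage_a_iterate (hF : LastReach m n hm hn k)
    (l : ℕ) (hS : SpreadCard k S)
    (hcl : S ∈ closedKL m n hm hn)
    (h : Prod.map (fullCycle hm)^[l] (fullCycle hn)^[l] ⁻¹' S ∈ closedKL m n hm hn →
      (dfaKL m n hm hn).StarReach (Prod.map (fullCycle hm)^[l] (fullCycle hn)^[l] ⁻¹' S)) :
    (dfaKL m n hm hn).StarReach S := by
  induction l generalizing S with
  | zero => exact h hcl
  | succ l ih =>
    -- Pulling back stops as soon as the start state appears; until then the preimage along `a`
    -- stays closed.
    by_cases h0 : (dfaKL m n hm hn).start ∈ S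
    · exact starReach_of_start_mem hF hS h0
    · rw [Function.iterate_succ', Function.iterate_succ'] at h
      exact DFA.StarReach.of_preimage (dfaKL_accept hm hn) hcl (dfaKL_bijective_a hm hn)
        (ih (hS.preimage (fullCycle_bijective hm) (fullCycle_bijective hn))
          (preimage_a_mem_closedKL hS.nonempty h0) h)

theorem fullCycle_iterate_eq {n : ℕ} (hn : 3 ≤ n) {l : ℕ} {i j : Fin n}
    (h : (i + l) % n = (j : ℕ)) : (fullCycle hn)^[l] i = j :=
  Fin.ext (by rw [val_fullCycle_iterate, h])

/-- Pulling back along `b` lowers `r`. The preimage fails to be closed only if `(m-1, 0) ∈ S` and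
`(0, 1) ∉ S`, and that case is treated through `a`. -/
theorem starReach_of_row_zero_mem (hF : LastReach m n hm hn k)
    (r : ℕ) (hr : r < n) (hS : SpreadCard k S)
    (hcl : S ∈ closedKL m n hm hn) (h : (⟨0, by omega⟩, ⟨r, hr⟩) ∈ S) :
    (dfaKL m n hm hn).StarReach S := by
  induction r generalizing S with
  | zero => exact starReach_of_start_mem hF hS h
  | succ r ih =>
    have hb0 : fullCycle hn ⟨0, by omega⟩ = ⟨1, by omega⟩ := by
      unfold fullCycle
      rw [dif_pos (by simp only []; omega)]
    have hb1 : ∀ T : Set (Fin m × Fin n), (⟨0, by omega⟩, ⟨1, by omega⟩) ∈ T →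
        (dfaKL m n hm hn).start ∈ ((dfaKL m n hm hn).step · .b) ⁻¹' T := by
      intro T hT
      rw [dfaKL_start, dfaKL_step_b, Set.mem_preimage, Prod.map_apply, hb0]
      exact hT
    by_cases hbad : (⟨m - 1, by omega⟩, ⟨0, by omega⟩) ∈ S ∧ (⟨0, by omega⟩, ⟨1, by omega⟩) ∉ S
    -- As `a^(mn)` is the identity, the preimage under `a^(mn-1)` is the forward image under `a`. It
    -- contains `(0, 1)`, the image of `(m-1, 0)`, and one preimage along `b` then contains the
    -- start state.
    · refine starReach_of_preimage_a_iterate hF (m * n - 1) hS hcl fun hT => ?_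
      refine DFA.StarReach.of_preimage (dfaKL_accept hm hn) hT (dfaKL_bijective_b hm hn) ?_
      refine starReach_of_start_mem hF ?_ (hb1 _ ?_)
      · exact (hS.preimage ((fullCycle_bijective hm).iterate _)
          ((fullCycle_bijective hn).iterate _)).preimage Function.bijective_id
          (fullCycle_bijective hn)
      · rw [Set.mem_preimage, Prod.map_apply, fullCycle_iterate_eq hm (j := ⟨m - 1, by omega⟩),
          fullCycle_iterate_eq hn (j := ⟨0, by omega⟩)]
        · exact hbad.1
        · have : 0 < m * n := by positivity
          rw [show 1 + (m * n - 1) = m * n by omega, Nat.mul_mod_left]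
        · obtain ⟨t, rfl⟩ := Nat.exists_eq_add_of_le' (show 1 ≤ n by omega)
          rw [show 0 + (m * (t + 1) - 1) = (m - 1) + m * t by rw [Nat.mul_succ]; omega,
            Nat.add_mul_mod_self_left, Nat.mod_eq_of_lt (by omega)]
    · refine DFA.StarReach.of_preimage (dfaKL_accept hm hn) hcl (dfaKL_bijective_b hm hn) ?_
      refine ih (by omega) (hS.preimage Function.bijective_id (fullCycle_bijective hn))
        ⟨hS.nonempty.preimage (dfaKL_bijective_b hm hn).2, fun hlast => hb1 _ ?_⟩ ?_
      · rw [dfaKL_step_b, Set.mem_preimage, Prod.map_apply, fullCycle_last] at hlast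
        by_contra hc
        exact hbad ⟨hlast, hc⟩
      · rw [dfaKL_step_b, Set.mem_preimage, Prod.map_apply]
        have : fullCycle hn ⟨r, by omega⟩ = ⟨r + 1, hr⟩ := by
          unfold fullCycle
          rw [dif_pos hr]
        rw [this]
        exact h

theorem starReach_of_spreadCard (hF : LastReach m n hm hn k)
    (hS : SpreadCard k S) (hcl : S ∈ closedKL m n hm hn) :
    (dfaKL m n hm hn).StarReach S := by
  obtain ⟨⟨i, j⟩, hp⟩ := hS.nonempty
  refine starReach_of_preimage_a_iterate hF i hS hcl fun hT => ?_
  obtain ⟨t, ht⟩ := ((fullCycle_bijective hn).iterate i).2 j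
  refine starReach_of_row_zero_mem hF t t.2 (hS.preimage ((fullCycle_bijective hm).iterate _)
    ((fullCycle_bijective hn).iterate _)) hT ?_
  rw [Set.mem_preimage, Prod.map_apply, ht,
    fullCycle_iterate_eq hm (j := i) (by simp [Nat.mod_eq_of_lt i.2])]
  exact hp

end Reach

/-! ### Sets inside one row or one column -/

namespace DFA

theorem starSubset_step_singleton {α σ : Type} (M : DFA α σ) {p : σ} {x : α}
    (h : M.step p x ∉ M.accept) : M.starSubset.step {p} x = {M.step p x} := by
  ext q
  rw [mem_starSubset_step]
  simp [h, eq_comm]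

end DFA

/-- Two elements in different rows share a column; an element off that column would have to lie in
both rows. -/
theorem same_row_or_same_column {β γ : Type} {S : Set (β × γ)} (h : ¬ Spread S) :
    (∀ p ∈ S, ∀ q ∈ S, p.1 = q.1) ∨ (∀ p ∈ S, ∀ q ∈ S, p.2 = q.2) := by
  have h' : ∀ p ∈ S, ∀ q ∈ S, p.1 ≠ q.1 → p.2 = q.2 := fun p hp q hq h1 => by
    by_contra h2
    exact h ⟨p, hp, q, hq, h1, h2⟩
  by_contra! hc
  obtain ⟨⟨p, hp, q, hq, hpq⟩, r, hr, s, hs, hrs⟩ := hc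
  have hpq2 := h' p hp q hq hpq
  have key : ∀ t ∈ S, t.2 = p.2 := fun t ht => by
    by_contra ht2
    have h1 : t.1 = p.1 := by
      by_contra h1
      exact ht2 (h' t ht p hp h1)
    exact ht2 ((h' t ht q hq fun h => hpq (h1.symm.trans h)).trans hpq2.symm)
  exact hrs ((key r hr).trans (key s hs).symm)

theorem oneToZero_one {n : ℕ} (hn : 3 ≤ n) : oneToZero hn ⟨1, by omega⟩ = ⟨0, by omega⟩ := by
  simp [oneToZero]

theorem oneToZero_zero {n : ℕ} (hn : 3 ≤ n) : oneToZero hn ⟨0, by omega⟩ = ⟨0, by omega⟩ := by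
  simp [oneToZero]

section Lines

variable {m n : ℕ} {hm : 3 ≤ m} {hn : 3 ≤ n}

theorem starReach_singleton_row_zero (j : Fin n) :
    (dfaKL m n hm hn).StarReach {(⟨0, by omega⟩, j)} := by
  have hacc : ∀ j : Fin n, (dfaKL m n hm hn).step (⟨0, by omega⟩, j) .b ∉
      (dfaKL m n hm hn).accept := by
    intro j
    rw [dfaKL_accept]
    intro h
    have h : 0 = m - 1 := congrArg (fun p : Fin m × Fin n => (p.1 : ℕ)) h
    omega
  have key : ∀ l : ℕ, (dfaKL m n hm hn).StarReach
      {(⟨0, by omega⟩, (fullCycle hn)^[l + 1] ⟨0, by omega⟩)} := by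
    intro l
    induction l with
    | zero => exact ⟨[.b], by simp, DFA.starSubset_step_singleton _ (hacc _)⟩
    | succ l ih =>
      have := ih.step .b
      rw [DFA.starSubset_step_singleton _ (hacc _)] at this
      rw [Function.iterate_succ_apply']
      exact this
  -- The word is `b^(j+n)` rather than `b^j`, hence nonempty even for `j = 0`.
  have hj := key (j + n - 1)
  rwa [fullCycle_iterate_eq hn (j := j)] at hj
  rw [show 0 + (j + n - 1 + 1) = j + n by omega, Nat.add_mod_right, Nat.mod_eq_of_lt j.2]

variable {k : ℕ} {S : Set (Fin m × Fin n)}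

/-- Unless `S` is a singleton, lifting one element to row `1` gives a spread set of the same size,
which `e` merges back to `S`. The lifted set is closed because `m - 1 > 1` keeps it away from the
accepting state. -/
theorem starReach_of_row_zero
    (hsp : ∀ T ∈ closedKL m n hm hn, SpreadCard k T → (dfaKL m n hm hn).StarReach T)
    (hcl : S ∈ closedKL m n hm hn) (hk : S.ncard = k) (hrow : ∀ p ∈ S, (p.1 : ℕ) = 0) :
    (dfaKL m n hm hn).StarReach S := by
  obtain ⟨⟨i, j⟩, hp⟩ := hcl.1
  obtain rfl : i = ⟨0, by omega⟩ := Fin.ext (hrow _ hp)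
  by_cases hsub : S ⊆ {(⟨0, by omega⟩, j)}
  · rw [(Set.Nonempty.subset_singleton_iff hcl.1).1 hsub]
    exact starReach_singleton_row_zero j
  obtain ⟨⟨i', j'⟩, hq, hne⟩ := Set.not_subset.1 hsub
  obtain rfl : i' = ⟨0, by omega⟩ := Fin.ext (hrow _ hq)
  have hjj : j' ≠ j := fun h => hne (by rw [h]; rfl)
  set T : Set (Fin m × Fin n) := insert (⟨1, by omega⟩, j) (S \ {(⟨0, by omega⟩, j)}) with hT
  have h1S : ((⟨1, by omega⟩, j) : Fin m × Fin n) ∉ S := fun h => by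
    have := hrow _ h
    simp at this
  have hTrow : ∀ p ∈ T, (p.1 : ℕ) ≤ 1 := by
    rintro p (rfl | hp)
    · simp
    · rw [hrow _ hp.1]
      omega
  refine DFA.StarReach.of_image (T := T) (x := .e) (dfaKL_accept hm hn) (hsp T ⟨?_, ?_⟩ ⟨?_, ?_⟩)
    ?_ ?_
  · exact ⟨_, Set.mem_insert _ _⟩
  · intro h
    have : m - 1 ≤ 1 := hTrow _ h
    omega
  · refine ⟨_, Set.mem_insert _ _, (⟨0, by omega⟩, j'), Or.inr ⟨hq, hne⟩, ?_, hjj.symm⟩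
    simp
  · rw [hT, Set.ncard_exchange h1S hp, hk]
  · rw [dfaKL_step_e, hT, Set.image_insert_eq, Prod.map_apply, oneToZero_one]
    have : Prod.map (oneToZero hm) id '' (S \ {(⟨0, by omega⟩, j)}) =
        S \ {(⟨0, by omega⟩, j)} := by
      conv_rhs => rw [← Set.image_id (S \ {(⟨0, by omega⟩, j)})]
      refine Set.image_congr fun p hp => ?_
      obtain ⟨i, j⟩ := p
      obtain rfl : i = ⟨0, by omega⟩ := Fin.ext (hrow _ hp.1)
      rw [Prod.map_apply, oneToZero_zero]
      rfl
    rw [this]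
    exact Set.insert_sdiff_self_of_mem hp
  · intro h
    have : m - 1 = 0 := hrow _ h
    omega

/-- The same argument with `f`, moving one element to column `1`; the two distinct rows make the
moved set spread. -/
theorem starReach_of_column_zero
    (hsp : ∀ T ∈ closedKL m n hm hn, SpreadCard k T → (dfaKL m n hm hn).StarReach T)
    (hk : S.ncard = k) (hcol : ∀ p ∈ S, (p.2 : ℕ) = 0)
    (hrow : ¬ ∀ p ∈ S, ∀ q ∈ S, p.1 = q.1) :
    (dfaKL m n hm hn).StarReach S := by
  push Not at hrow
  obtain ⟨⟨i, j⟩, hp, ⟨i', j'⟩, hq, hii⟩ := hrow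
  obtain rfl : j = ⟨0, by omega⟩ := Fin.ext (hcol _ hp)
  obtain rfl : j' = ⟨0, by omega⟩ := Fin.ext (hcol _ hq)
  set T : Set (Fin m × Fin n) := insert (i, ⟨1, by omega⟩) (S \ {(i, ⟨0, by omega⟩)}) with hT
  have h1S : ((i, ⟨1, by omega⟩) : Fin m × Fin n) ∉ S := fun h => by
    have := hcol _ h
    simp at this
  have hTcol : ∀ p ∈ T, (p.2 : ℕ) ≤ 1 := by
    rintro p (rfl | hp)
    · simp
    · rw [hcol _ hp.1]
      omega
  refine DFA.StarReach.of_image (T := T) (x := .f) (dfaKL_accept hm hn) (hsp T ⟨?_, ?_⟩ ⟨?_, ?_⟩)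
    ?_ ?_
  · exact ⟨_, Set.mem_insert _ _⟩
  · intro h
    have : n - 1 ≤ 1 := hTcol _ h
    omega
  · refine ⟨_, Set.mem_insert _ _, (i', ⟨0, by omega⟩), Or.inr ⟨hq, ?_⟩, hii, ?_⟩
    · exact fun h => hii (congrArg Prod.fst h).symm
    · simp
  · rw [hT, Set.ncard_exchange h1S hp, hk]
  · rw [dfaKL_step_f, hT, Set.image_insert_eq, Prod.map_apply, oneToZero_one]
    have : Prod.map id (oneToZero hn) '' (S \ {(i, ⟨0, by omega⟩)}) =
        S \ {(i, ⟨0, by omega⟩)} := by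
      conv_rhs => rw [← Set.image_id (S \ {(i, ⟨0, by omega⟩)})]
      refine Set.image_congr fun p hp => ?_
      obtain ⟨i, j⟩ := p
      obtain rfl : j = ⟨0, by omega⟩ := Fin.ext (hcol _ hp.1)
      rw [Prod.map_apply, oneToZero_zero]
      rfl
    rw [this]
    exact Set.insert_sdiff_self_of_mem hp
  · intro h
    have : n - 1 = 0 := hcol _ h
    omega

theorem val_eq_of_val_fullCycle_eq_succ {i : Fin n} {r : ℕ} (h : (fullCycle hn i : ℕ) = r + 1) :
    (i : ℕ) = r := by
  unfold fullCycle at h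
  split_ifs at h
  simpa using h

theorem starReach_of_row
    (hsp : ∀ T ∈ closedKL m n hm hn, SpreadCard k T → (dfaKL m n hm hn).StarReach T)
    (hcl : S ∈ closedKL m n hm hn) (hk : S.ncard = k) (r : ℕ) (hrow : ∀ p ∈ S, (p.1 : ℕ) = r) :
    (dfaKL m n hm hn).StarReach S := by
  induction r generalizing S with
  | zero => exact starReach_of_row_zero hsp hcl hk hrow
  | succ r ih =>
    refine DFA.StarReach.of_preimage (dfaKL_accept hm hn) hcl (dfaKL_bijective_a hm hn)
      (ih (preimage_a_mem_closedKL hcl.1 fun h => ?_) ?_ fun p hp => ?_)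
    · exact absurd (hrow _ h) (Nat.succ_ne_zero r).symm
    · rw [ncard_preimage_of_bijective (dfaKL_bijective_a hm hn), hk]
    · exact val_eq_of_val_fullCycle_eq_succ (hn := hm) (hrow _ hp)

theorem starReach_of_column
    (hsp : ∀ T ∈ closedKL m n hm hn, SpreadCard k T → (dfaKL m n hm hn).StarReach T)
    (hcl : S ∈ closedKL m n hm hn) (hk : S.ncard = k) (r : ℕ) (hcol : ∀ p ∈ S, (p.2 : ℕ) = r)
    (hrow : ¬ ∀ p ∈ S, ∀ q ∈ S, p.1 = q.1) :
    (dfaKL m n hm hn).StarReach S := by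
  induction r generalizing S with
  | zero => exact starReach_of_column_zero hsp hk hcol hrow
  | succ r ih =>
    refine DFA.StarReach.of_preimage (dfaKL_accept hm hn) hcl (dfaKL_bijective_a hm hn)
      (ih (preimage_a_mem_closedKL hcl.1 fun h => ?_) ?_ (fun p hp => ?_) fun h => hrow ?_)
    · exact absurd (hcol _ h) (Nat.succ_ne_zero r).symm
    · rw [ncard_preimage_of_bijective (dfaKL_bijective_a hm hn), hk]
    · exact val_eq_of_val_fullCycle_eq_succ (hn := hn) (hcol _ hp)
    · intro p hp q hq
      obtain ⟨p, rfl⟩ := (dfaKL_bijective_a hm hn).2 p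
      obtain ⟨q, rfl⟩ := (dfaKL_bijective_a hm hn).2 q
      exact congrArg (fullCycle hm) (h p hp q hq)

/-- Every closed set is reachable by a nonempty word. -/
theorem starReach_of_mem_closedKL (hcl : S ∈ closedKL m n hm hn) :
    (dfaKL m n hm hn).StarReach S := by
  induction hk : S.ncard using Nat.strong_induction_on generalizing S with
  | _ k ih =>
    -- Only here is the induction hypothesis used; all other reductions keep the cardinality `k`.
    have hlast : ∀ T ∈ closedKL m n hm hn, T.ncard = k →
        (⟨m - 1, by omega⟩, ⟨n - 1, by omega⟩) ∈ T → (dfaKL m n hm hn).StarReach T := by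
      intro T hT hTk hlT
      refine DFA.StarReach.of_mem_accept (dfaKL_accept hm hn) last_ne_start hT hlT
        (dfaKL_bijective_a hm hn) ?_ fun U hU hlt => ih _ (hTk ▸ hlt) hU rfl
      exact Prod.ext (fullCycle_last hm) (fullCycle_last hn)
    have hF : LastReach m n hm hn k := fun T hT h0 hl =>
      hlast T (closedKL_of_start_mem h0) hT.2 hl
    have hsp : ∀ T ∈ closedKL m n hm hn, SpreadCard k T → (dfaKL m n hm hn).StarReach T :=
      fun T hT h => starReach_of_spreadCard hF h hT
    by_cases hS : Spread S
    · exact hsp S hcl ⟨hS, hk⟩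
    obtain ⟨p, hp⟩ := hcl.1
    by_cases hrow : ∀ p ∈ S, ∀ q ∈ S, p.1 = q.1
    · exact starReach_of_row hsp hcl hk p.1 fun q hq => congrArg Fin.val (hrow q hq p hp)
    · have hcol := (same_row_or_same_column hS).resolve_left hrow
      exact starReach_of_column hsp hcl hk p.2 (fun q hq => congrArg Fin.val (hcol q hq p hp)) hrow

end Lines

/-! ### Minimality of the witnesses and conclusion -/

/-- A DFA on `Fin n` with start state `0` and accepting state `n - 1`, one letter of which is the
full cycle, is minimal. -/
theorem stateComplexity_of_step_fullCycle {α : Type} {n : ℕ} (hn : 3 ≤ n) (M : DFA α (Fin n))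
    (x : α) (hx : (M.step · x) = fullCycle hn) (hs : M.start = ⟨0, by omega⟩)
    (ha : M.accept = {⟨n - 1, by omega⟩}) : stateComplexity M.accepts = n := by
  rw [stateComplexity_eq_card M, Nat.card_fin]
  · intro i
    refine ⟨List.replicate i x, ?_⟩
    rw [DFA.eval, DFA.evalFrom_replicate, hx, hs]
    exact fullCycle_iterate_eq hn (by simp [Nat.mod_eq_of_lt i.2])
  · intro i j h
    have hmem : List.replicate (n - 1 - i) x ∈ M.acceptsFrom i := by
      rw [DFA.mem_acceptsFrom, DFA.evalFrom_replicate, hx, ha]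
      refine fullCycle_iterate_eq hn ?_
      rw [show (i : ℕ) + (n - 1 - i) = n - 1 by omega, Nat.mod_eq_of_lt (by omega)]
    have hmem' := hmem
    rw [h] at hmem'
    rw [DFA.mem_acceptsFrom, DFA.evalFrom_replicate, hx, ha, Set.mem_singleton_iff] at hmem hmem'
    exact ((fullCycle_bijective hn).iterate _).1 (hmem.trans hmem'.symm)

theorem stateComplexity_witnessK (m : ℕ) (hm : 3 ≤ m) : stateComplexity (witnessK m hm) = m :=
  stateComplexity_of_step_fullCycle hm (dfaK m hm) .a rfl rfl rfl

theorem stateComplexity_witnessL_compl (n : ℕ) (hn : 3 ≤ n) :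
    stateComplexity (witnessL n hn)ᶜ = n := by
  rw [stateComplexity_compl]
  exact stateComplexity_of_step_fullCycle hn (dfaL n hn) .a rfl rfl rfl

theorem stateComplexity_starDiff_witness (m n : ℕ) (hm : 3 ≤ m) (hn : 3 ≤ n) :
    stateComplexity (starDiff (witnessK m hm) (witnessL n hn)ᶜ) =
      ((2 ^ (m * n - 1) + 2 ^ (m * n - 2) : ℕ) : ℕ∞) := by
  refine le_antisymm (stateComplexity_starDiff_le hm hn (stateComplexity_witnessK m hm)
    (stateComplexity_witnessL_compl n hn)) ?_
  have hP : starDiff (witnessK m hm) (witnessL n hn)ᶜ = (dfaKL m n hm hn).accepts∗ := by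
    rw [DFA.accepts_inter, starDiff, sdiff_compl]
    rfl
  have hcard : Nat.card (Fin m × Fin n) = m * n := by simp
  rw [hP, ← hcard]
  refine le_stateComplexity_kstar (dfaKL m n hm hn) ?_ last_ne_start
    (fun S hS => starReach_of_mem_closedKL hS) (exists_distinguishing_word hm hn)
  rw [dfaKL_accept]
  exact fun h => last_ne_start (Set.mem_singleton_iff.1 h).symm

theorem mainTheorem10 (m n : ℕ) (hm : 3 ≤ m) (hn : 3 ≤ n) :
    IsOperationComplexity starDiff m n ((2 ^ (m * n - 1) + 2 ^ (m * n - 2) : ℕ) : ℕ∞) ∧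
    stateComplexity (witnessK m hm) = (m : ℕ∞) ∧
    stateComplexity (witnessL n hn)ᶜ = (n : ℕ∞) ∧
    stateComplexity (starDiff (witnessK m hm) (witnessL n hn)ᶜ) =
      ((2 ^ (m * n - 1) + 2 ^ (m * n - 2) : ℕ) : ℕ∞) := by
  refine ⟨⟨⟨Letter, inferInstance, witnessK m hm, (witnessL n hn)ᶜ, stateComplexity_witnessK m hm,
    stateComplexity_witnessL_compl n hn, (stateComplexity_starDiff_witness m n hm hn).symm⟩, ?_⟩,
    stateComplexity_witnessK m hm, stateComplexity_witnessL_compl n hn,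
    stateComplexity_starDiff_witness m n hm hn⟩
  rintro _ ⟨α, -, K, L, hK, hL, rfl⟩
  exact stateComplexity_starDiff_le hm hn hK hL
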